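/- Let $k\ge 2$ be an integer and let $1/2<d<1$. For $n\ge 2$ let $R$ be chosen uniformly at random among all sets of exactly $N$ distinct positive words of length $k$ over the alphabet $\{a_1,\dots,a_n\}$ (words in which no inverse of a generator occurs), where $N=\lfloor n^{kd}\rfloor$, and let $G=\langle a_1,\dots,a_n\mid R\rangle$ be the resulting random group in the positive $(n,k,d)$ model. Then, with probability tending to $1$ as $n\to\infty$ with $k$ and $d$ fixed, $G\cong\mathbb{Z}_k$ (the cyclic group of order $k$) and $a_1=_G a_2=_G\cdots=_G a_n$. The same holds if the number of relators is taken to be $N=\lfloor(2n-1)^{kd}\rfloor$ instead (for which such sets $R$ exist once $n$ is large enough). -/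

import Mathlib

open Filter Topology

/-- The positive word `a_{w 0} a_{w 1} ⋯ a_{w (k-1)}` of length `k`, as an element of the free group
on `a_0, …, a_{n-1}`. The words of length `k` over the alphabet are the functions
`w : Fin k → Fin n`. -/
def positiveWord {n k : ℕ} (w : Fin k → Fin n) : FreeGroup (Fin n) :=
  (List.ofFn fun i => FreeGroup.of (w i)).prod

/-- The group `⟨a_0, …, a_{n-1} | R⟩` for a set `R` of positive words of length `k`. -/
abbrev PositiveGroup {n k : ℕ} (R : Finset (Fin k → Fin n)) : Type :=
  PresentedGroup (positiveWord '' (R : Set (Fin k → Fin n)))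

/-- The sample space: all sets of exactly `N` distinct positive words of length `k` over
an alphabet of `n` letters. -/
def relatorSets (n k N : ℕ) : Finset (Finset (Fin k → Fin n)) :=
  Finset.powersetCard N Finset.univ

open Classical in
/-- The probability that a set `R` of `N` positive words of length `k` over `n` letters, chosen
uniformly at random among all such sets, satisfies `P`. -/
noncomputable def positiveModelProb (n k N : ℕ) (P : Finset (Fin k → Fin n) → Prop) : ℝ :=
  (((relatorSets n k N).filter P).card : ℝ) / ((relatorSets n k N).card : ℝ)

/-- The group `⟨a_0, …, a_{n-1} | R⟩` is cyclic of order `k`, and all generators are equal in it. -/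
def IsCyclicWithEqualGenerators {n k : ℕ} (R : Finset (Fin k → Fin n)) : Prop :=
  Nonempty (PositiveGroup R ≃* Multiplicative (ZMod k)) ∧
    ∀ i j : Fin n, (PresentedGroup.of i : PositiveGroup R) = PresentedGroup.of j

/-!
All relators have length `k`, so sending every generator to `1` maps the group onto `ZMod k`; as soon
as one relator exists and all generators agree, this map is an isomorphism
(`isCyclicWithEqualGenerators_of_forall_eq`). The work is to show that all generators agree.

Write a word of length `k` as a pair (first letter, tail) and read `R` as a bipartite graph between
the `n` letters and the `n ^ (k - 1)` tails. Two letters with a common neighbour are equal in the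
group, so each class of letters with the same image in the group is a set along which the graph
splits. If there are two classes, one of them has at most `n / 2` letters
(`forall_of_eq_of_of_not_hasSmallSplit`). Hence it suffices that, with high probability, the graph
does not split along any nonempty set `S` of at most half of the letters.

Splitting is inherited by subsets, so its probability for a uniform `N`-set is at most its
probability for the set of values of a sequence of at most `N` independent uniform words
(`card_filter_powersetCard_mul_le`). Such a sequence is exposed in two rounds of `m` words each.

* By a union bound over sets `X` of letters and `T` of tails, after the first round every set of at
  least half of the letters has at least `t` neighbours, except with probability
  `2 ^ n * M ^ t * (3 / 4) ^ m`, where `M = n ^ (k - 1)` and `2 * t ≤ M` (`card_not_isSpread_le`).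
* Given this, a split along `S` forces every word of the second round to avoid the product of `S`
  with the neighbours of `Sᶜ`, which has probability at most `exp (-(t * m / n ^ k)) ^ #S`; summing
  over `S` gives a binomial expansion (`card_hasSmallSplit_union_le`).

With `m = ⌊n ^ c⌋` and `t = ⌊n ^ a⌋`, both errors tend to `0` provided `1 < c`, `a < c` and
`k < a + c`, while `2 * m ≤ N` and `2 * t ≤ M` need `c < k * d` and `a < k - 1`. Such exponents exist
because `k * d > k / 2`.
-/

/-! ### Presentations by positive words -/

theorem positiveWord_cons {n k : ℕ} (x : Fin n) (u : Fin k → Fin n) :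
    positiveWord (Fin.cons x u : Fin (k + 1) → Fin n) = FreeGroup.of x * positiveWord u := by
  simp [positiveWord, List.ofFn_succ]

theorem mk_positiveWord_eq_one {n k : ℕ} {R : Finset (Fin k → Fin n)} {w : Fin k → Fin n}
    (hw : w ∈ R) :
    PresentedGroup.mk (positiveWord '' (R : Set (Fin k → Fin n))) (positiveWord w) = 1 :=
  PresentedGroup.one_of_mem ⟨w, hw, rfl⟩

theorem of_eq_of_of_mem_cons {n k : ℕ} {R : Finset (Fin (k + 1) → Fin n)} {x y : Fin n}
    {u : Fin k → Fin n} (hx : Fin.cons x u ∈ R) (hy : Fin.cons y u ∈ R) :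
    (PresentedGroup.of x : PositiveGroup R) = PresentedGroup.of y := by
  have h := (mk_positiveWord_eq_one hx).trans (mk_positiveWord_eq_one hy).symm
  rw [positiveWord_cons, positiveWord_cons, map_mul, map_mul] at h
  exact mul_right_cancel h

theorem lift_positiveWord_const {n k : ℕ} {G : Type*} [Group G] (g : G) (w : Fin k → Fin n) :
    FreeGroup.lift (fun _ : Fin n => g) (positiveWord w) = g ^ k := by
  simp [positiveWord, map_list_prod, List.map_ofFn, Function.comp_def]

/-- If all generators agree then the group consists of the powers of one element `g`, and
`g ^ k = 1` by any relator. The homomorphism to `ZMod k` sending every generator to `1` exists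
because all relators have length `k`, and it shows that the order of `g` is exactly `k`. -/
theorem isCyclicWithEqualGenerators_of_forall_eq {n k : ℕ} {R : Finset (Fin k → Fin n)}
    (hk : k ≠ 0) (hR : R.Nonempty)
    (h : ∀ i j : Fin n, (PresentedGroup.of i : PositiveGroup R) = PresentedGroup.of j) :
    IsCyclicWithEqualGenerators R := by
  refine ⟨?_, h⟩
  obtain ⟨w, hw⟩ := hR
  set g : PositiveGroup R := PresentedGroup.of (w ⟨0, Nat.pos_of_ne_zero hk⟩) with hg
  have hmk : ∀ x : FreeGroup (Fin n),
      PresentedGroup.mk (positiveWord '' (R : Set (Fin k → Fin n))) x =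
        FreeGroup.lift (fun _ : Fin n => g) x := by
    intro x
    have : PresentedGroup.mk (positiveWord '' (R : Set (Fin k → Fin n))) =
        FreeGroup.lift (fun _ : Fin n => g) := by
      ext i
      rw [FreeGroup.lift_apply_of]
      exact h _ _
    rw [this]
  have hgk : g ^ k = 1 := by
    rw [← lift_positiveWord_const g w, ← hmk]
    exact mk_positiveWord_eq_one hw
  have hrel : ∀ r ∈ positiveWord '' (R : Set (Fin k → Fin n)),
      FreeGroup.lift (fun _ : Fin n => Multiplicative.ofAdd (1 : ZMod k)) r = 1 := by
    rintro _ ⟨v, -, rfl⟩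
    rw [lift_positiveWord_const, ← ofAdd_nsmul]
    simp
  let φ : PositiveGroup R →* Multiplicative (ZMod k) := PresentedGroup.toGroup hrel
  have hφ : ∀ j : ℤ, φ (g ^ j) = Multiplicative.ofAdd (j : ZMod k) := by
    intro j
    have : φ g = Multiplicative.ofAdd (1 : ZMod k) := PresentedGroup.toGroup.of hrel
    rw [map_zpow, this, ← ofAdd_zsmul]
    simp
  have hpow : ∀ x : PositiveGroup R, ∃ j : ℤ, g ^ j = x := by
    intro x
    obtain ⟨y, rfl⟩ := PresentedGroup.mk_surjective _ x
    rw [hmk]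
    induction y using FreeGroup.induction_on with
    | C1 => exact ⟨0, by simp⟩
    | of i => exact ⟨1, by simp⟩
    | inv_of i _ => exact ⟨-1, by simp⟩
    | mul x y hx hy =>
      obtain ⟨a, ha⟩ := hx
      obtain ⟨b, hb⟩ := hy
      exact ⟨a + b, by rw [zpow_add, ha, hb, map_mul]⟩
  refine ⟨MulEquiv.ofBijective φ ⟨?_, fun z => ?_⟩⟩
  · rw [injective_iff_map_eq_one]
    intro x hx
    obtain ⟨j, rfl⟩ := hpow x
    rw [hφ, ofAdd_eq_one, ZMod.intCast_zmod_eq_zero_iff_dvd] at hx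
    obtain ⟨c, rfl⟩ := hx
    rw [zpow_mul, zpow_natCast, hgk, one_zpow]
  · obtain ⟨j, hj⟩ := ZMod.intCast_surjective z.toAdd
    exact ⟨g ^ j, by rw [hφ, hj, ofAdd_toAdd]⟩

/-! ### Splittings of bipartite graphs -/

/-- A set `R ⊆ α × β`, read as a bipartite graph, *splits along* `S ⊆ α` if no vertex of `β` has
neighbours both inside and outside `S`. -/
def SplitsAlong {α β : Type*} (R : Finset (α × β)) (S : Finset α) : Prop :=
  ∀ x ∈ S, ∀ y ∉ S, ∀ u, (x, u) ∈ R → (y, u) ∉ R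

/-- `R ⊆ α × β` splits along some nonempty set with at most half of the elements of `α`. -/
def HasSmallSplit {α β : Type*} [Fintype α] (R : Finset (α × β)) : Prop :=
  ∃ S : Finset α, S.Nonempty ∧ 2 * S.card ≤ Fintype.card α ∧ SplitsAlong R S

theorem HasSmallSplit.anti {α β : Type*} [Fintype α] {R R' : Finset (α × β)} (h : R ⊆ R')
    (hR' : HasSmallSplit R') : HasSmallSplit R := by
  obtain ⟨S, h1, h2, h3⟩ := hR'
  exact ⟨S, h1, h2, fun x hx y hy u hxu hyu => h3 x hx y hy u (h hxu) (h hyu)⟩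

/-- If two generators differ in the group, the relators, as pairs (first letter, tail), split along
the class of either of them, and the smaller of the two classes has at most half of the letters. -/
theorem forall_of_eq_of_of_not_hasSmallSplit {n k : ℕ} {R : Finset (Fin (k + 1) → Fin n)}
    (hR : ¬ HasSmallSplit (R.map (Fin.consEquiv fun _ => Fin n).symm.toEmbedding)) (i j : Fin n) :
    (PresentedGroup.of i : PositiveGroup R) = PresentedGroup.of j := by
  classical
  by_contra hij
  let C : Fin n → Finset (Fin n) := fun a =>
    {b | (PresentedGroup.of b : PositiveGroup R) = PresentedGroup.of a}
  have hsplit : ∀ a, SplitsAlong (R.map (Fin.consEquiv fun _ => Fin n).symm.toEmbedding) (C a) := by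
    intro a x hx y hy u hxu hyu
    rw [Finset.mem_map_equiv, Equiv.symm_symm] at hxu hyu
    simp only [C, Finset.mem_filter, Finset.mem_univ, true_and] at hx hy
    exact hy ((of_eq_of_of_mem_cons hyu hxu).trans hx)
  have hdisj : Disjoint (C i) (C j) := by
    rw [Finset.disjoint_left]
    intro b hi hj
    simp only [C, Finset.mem_filter, Finset.mem_univ, true_and] at hi hj
    exact hij (hi.symm.trans hj)
  have hcard : (C i).card + (C j).card ≤ Fintype.card (Fin n) := by
    rw [← Finset.card_union_of_disjoint hdisj]
    exact Finset.card_le_univ _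
  have hne : ∀ a, (C a).Nonempty := fun a => ⟨a, by simp [C]⟩
  rcases le_total (C i).card (C j).card with h | h
  · exact hR ⟨C i, hne i, by omega, hsplit i⟩
  · exact hR ⟨C j, hne j, by omega, hsplit j⟩

/-! ### Uniform subsets and independent sequences -/

theorem exists_perm_map_eq {E : Type*} [Fintype E] [DecidableEq E] {s t : Finset E}
    (h : s.card = t.card) : ∃ τ : Equiv.Perm E, s.map τ.toEmbedding = t := by
  let e : {x // x ∈ s} ≃ {x // x ∈ t} := Finset.equivOfCardEq h
  refine ⟨e.extendSubtype, Finset.eq_of_subset_of_card_le ?_ (by simp [h])⟩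
  intro y hy
  obtain ⟨x, hx, rfl⟩ := Finset.mem_map.1 hy
  exact e.extendSubtype_mem x hx

open Classical in
/-- For a property `B` inherited by subsets, the probability that a uniform `N`-set satisfies `B` is
at most the probability that the set of values of a uniform sequence of at most `N` elements does.
Applying a uniform permutation to any fixed `N`-set gives a uniform `N`-set, applying it to a uniform
sequence gives a uniform sequence, and the values of any sequence lie in some `N`-set. -/
theorem card_filter_powersetCard_mul_le {E ι : Type*} [Fintype E] [Fintype ι]
    {B : Finset E → Prop} (hB : ∀ s t, s ⊆ t → B t → B s) {N : ℕ}
    (hι : Fintype.card ι ≤ N) (hN : N ≤ Fintype.card E) :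
    ((Finset.powersetCard N Finset.univ).filter B).card * Fintype.card E ^ Fintype.card ι ≤
      (Finset.univ.filter fun f : ι → E => B (Finset.univ.image f)).card *
        (Fintype.card E).choose N := by
  -- The number of permutations carrying `R` to a set with `B` depends only on the size of `R`.
  let c : Finset E → ℕ := fun R =>
    (Finset.univ.filter fun σ : Equiv.Perm E => B (R.map σ.toEmbedding)).card
  have hc : ∀ R R' : Finset E, R.card = R'.card → c R = c R' := by
    intro R R' h
    obtain ⟨τ, rfl⟩ := exists_perm_map_eq h
    refine Finset.card_equiv (Equiv.mulRight τ⁻¹) fun σ => ?_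
    simp only [Finset.mem_filter, Finset.mem_univ, true_and, Finset.map_map]
    congr! 2
    ext x
    simp
  have hsum : ∑ R ∈ Finset.powersetCard N Finset.univ, c R =
      Fintype.card (Equiv.Perm E) * ((Finset.powersetCard N Finset.univ).filter B).card := by
    simp only [c, Finset.card_filter]
    rw [Finset.sum_comm, ← Finset.card_univ, ← smul_eq_mul, ← Finset.sum_const]
    refine Finset.sum_congr rfl fun σ _ => ?_
    refine Finset.sum_equiv (Equiv.finsetCongr σ) (fun R => ?_) (fun R _ => ?_)
    · simp [Finset.mem_powersetCard]
    · simp only [Equiv.finsetCongr_apply]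
      congr
  have hseq : ∑ f : ι → E, (Finset.univ.filter fun σ : Equiv.Perm E =>
        B (Finset.univ.image (σ ∘ f))).card =
      Fintype.card (Equiv.Perm E) *
        (Finset.univ.filter fun f : ι → E => B (Finset.univ.image f)).card := by
    simp only [Finset.card_filter]
    rw [Finset.sum_comm, ← Finset.card_univ, ← smul_eq_mul, ← Finset.sum_const]
    refine Finset.sum_congr rfl fun σ _ => ?_
    exact Fintype.sum_equiv (Equiv.arrowCongr (Equiv.refl ι) σ) _ _ fun f => rfl
  obtain ⟨R₀, -, hR₀⟩ : ∃ R₀ ⊆ (Finset.univ : Finset E), R₀.card = N :=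
    Finset.exists_subset_card_eq (by simpa using hN)
  have h1 : (Fintype.card E).choose N * c R₀ =
      Fintype.card (Equiv.Perm E) * ((Finset.powersetCard N Finset.univ).filter B).card := by
    rw [← hsum, Finset.sum_congr rfl fun R hR =>
      hc R R₀ ((Finset.mem_powersetCard.1 hR).2.trans hR₀.symm)]
    simp
  have h2 : Fintype.card E ^ Fintype.card ι * c R₀ ≤ Fintype.card (Equiv.Perm E) *
      (Finset.univ.filter fun f : ι → E => B (Finset.univ.image f)).card := by
    have hcst : Fintype.card E ^ Fintype.card ι * c R₀ = ∑ _f : ι → E, c R₀ := by simp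
    rw [← hseq, hcst]
    refine Finset.sum_le_sum fun f _ => ?_
    obtain ⟨R, hfR, -, hR⟩ := Finset.exists_subsuperset_card_eq
      (Finset.subset_univ (Finset.univ.image f)) (Finset.card_image_le.trans hι)
      (by simpa using hN)
    rw [hc R₀ R (hR₀.trans hR.symm)]
    refine Finset.card_le_card fun σ hσ => ?_
    simp only [Finset.mem_filter, Finset.mem_univ, true_and] at hσ ⊢
    refine hB _ _ ?_ hσ
    rw [← Finset.image_image, Finset.map_eq_image]
    exact Finset.image_subset_image hfR
  have hpos : 0 < Fintype.card (Equiv.Perm E) := Fintype.card_pos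
  refine Nat.le_of_mul_le_mul_left ?_ hpos
  calc _ = ((Fintype.card E).choose N * c R₀) * Fintype.card E ^ Fintype.card ι := by
        rw [h1]; ring
    _ = (Fintype.card E).choose N * (Fintype.card E ^ Fintype.card ι * c R₀) := by ring
    _ ≤ _ := Nat.mul_le_mul_left _ h2
    _ = _ := by ring

/-! ### Two-round exposure -/

open Classical in
/-- The vertices of `β` that the bipartite graph `R` joins to a vertex of `X`. -/
noncomputable def neighbors {α β : Type*} (R : Finset (α × β)) (X : Finset α) : Finset β :=
  (R.filter fun p => p.1 ∈ X).image Prod.snd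

theorem mem_neighbors {α β : Type*} {R : Finset (α × β)} {X : Finset α} {u : β} :
    u ∈ neighbors R X ↔ ∃ x ∈ X, (x, u) ∈ R := by
  simp only [neighbors, Finset.mem_image, Finset.mem_filter, Prod.exists, exists_eq_right]
  exact exists_congr fun x => and_comm

/-- Every set of at least half of the vertices of `α` has at least `t` neighbours in the bipartite
graph `R`. -/
def IsSpread {α β : Type*} [Fintype α] (t : ℕ) (R : Finset (α × β)) : Prop :=
  ∀ X : Finset α, Fintype.card α ≤ 2 * X.card → t ≤ (neighbors R X).card

theorem card_compl_product {α β : Type*} [Fintype α] [Fintype β] [DecidableEq α] [DecidableEq β]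
    (X : Finset α) (T : Finset β) :
    ((X ×ˢ T)ᶜ.card : ℝ) = Fintype.card α * Fintype.card β - X.card * T.card := by
  rw [Finset.card_compl, Nat.cast_sub (Finset.card_le_univ _)]
  simp

open Classical in
/-- Union bound over a set `X` with few neighbours and a set `T` of size `t` containing them: every
edge drawn avoids `X ×ˢ Tᶜ`, which is at least a quarter of `α × β`. -/
theorem card_not_isSpread_le {α β : Type*} [Fintype α] [Fintype β] (m : ℕ) {t : ℕ}
    (ht : 2 * t ≤ Fintype.card β) :
    ((Finset.univ.filter fun f : Fin m → α × β => ¬ IsSpread t (Finset.univ.image f)).card : ℝ) ≤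
      2 ^ Fintype.card α * (Fintype.card β : ℝ) ^ t * (3 / 4) ^ m *
        (Fintype.card α * Fintype.card β) ^ m := by
  let I : Finset (Finset α × Finset β) :=
    (Finset.univ.filter fun X : Finset α => Fintype.card α ≤ 2 * X.card) ×ˢ
      Finset.powersetCard t Finset.univ
  have hsub : (Finset.univ.filter fun f : Fin m → α × β =>
      ¬ IsSpread t (Finset.univ.image f)) ⊆
      I.biUnion fun p => Fintype.piFinset fun _ : Fin m => (p.1 ×ˢ p.2ᶜ)ᶜ := by
    intro f hf
    simp only [Finset.mem_filter, Finset.mem_univ, true_and, IsSpread, not_forall,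
      not_le] at hf
    obtain ⟨X, hX, hlt⟩ := hf
    obtain ⟨T, hT, -, hTc⟩ := Finset.exists_subsuperset_card_eq
      (Finset.subset_univ (neighbors (Finset.univ.image f) X)) hlt.le
      (by rw [Finset.card_univ]; omega)
    rw [Finset.mem_biUnion]
    refine ⟨(X, T), by simp [I, hX, hTc], ?_⟩
    rw [Fintype.mem_piFinset]
    intro i
    rw [Finset.mem_compl, Finset.mem_product, Finset.mem_compl]
    rintro ⟨h1, h2⟩
    exact h2 (hT (mem_neighbors.2 ⟨_, h1, by simp⟩))
  have hI : (I.card : ℝ) ≤ 2 ^ Fintype.card α * (Fintype.card β : ℝ) ^ t := by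
    have : I.card ≤ 2 ^ Fintype.card α * Fintype.card β ^ t := by
      rw [Finset.card_product]
      refine Nat.mul_le_mul ((Finset.card_le_univ _).trans (by simp)) ?_
      rw [Finset.card_powersetCard, Finset.card_univ]
      exact Nat.choose_le_pow _ _
    exact_mod_cast this
  have hterm : ∀ p ∈ I, ((Fintype.piFinset fun _ : Fin m => (p.1 ×ˢ p.2ᶜ)ᶜ).card : ℝ) ≤
      (3 / 4 * (Fintype.card α * Fintype.card β)) ^ m := by
    rintro ⟨X, T⟩ hp
    simp only [I, Finset.mem_product, Finset.mem_filter, Finset.mem_univ, true_and,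
      Finset.mem_powersetCard_univ] at hp
    rw [Fintype.card_piFinset_const, Nat.cast_pow]
    refine pow_le_pow_left₀ (Nat.cast_nonneg _) ?_ m
    rw [card_compl_product, Finset.card_compl, Nat.cast_sub (Finset.card_le_univ _), hp.2]
    have h1 : (Fintype.card α : ℝ) ≤ 2 * X.card := by exact_mod_cast hp.1
    have h2 : 2 * (t : ℝ) ≤ Fintype.card β := by exact_mod_cast ht
    have h3 : (Fintype.card α : ℝ) * Fintype.card β ≤
        (2 * X.card) * (2 * (Fintype.card β - t)) :=
      mul_le_mul h1 (by linarith) (Nat.cast_nonneg _) (by positivity)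
    linarith
  calc _ ≤ ((I.biUnion fun p => Fintype.piFinset fun _ : Fin m => (p.1 ×ˢ p.2ᶜ)ᶜ).card : ℝ) := by
        exact_mod_cast Finset.card_le_card hsub
    _ ≤ ∑ p ∈ I, ((Fintype.piFinset fun _ : Fin m => (p.1 ×ˢ p.2ᶜ)ᶜ).card : ℝ) := by
        exact_mod_cast Finset.card_biUnion_le
    _ ≤ I.card * (3 / 4 * (Fintype.card α * Fintype.card β)) ^ m := by
        rw [← nsmul_eq_mul]
        exact Finset.sum_le_card_nsmul _ _ _ hterm
    _ ≤ 2 ^ Fintype.card α * (Fintype.card β : ℝ) ^ t *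
          (3 / 4 * (Fintype.card α * Fintype.card β)) ^ m := by gcongr
    _ = _ := by rw [mul_pow]; ring

open Classical in
theorem sum_nonempty_pow_card_le {α : Type*} [Fintype α] {q : ℝ} (hq : 0 ≤ q) :
    ∑ S ∈ Finset.univ.filter (fun S : Finset α => S.Nonempty), q ^ S.card ≤
      Real.exp (Fintype.card α * q) - 1 := by
  have h1 : ∑ S : Finset α, q ^ S.card = (q + 1) ^ Fintype.card α := by
    have := Finset.sum_pow_mul_eq_add_pow q 1 (Finset.univ : Finset α)
    simpa using this
  have h2 : ∑ S : Finset α, q ^ S.card =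
      ∑ S ∈ Finset.univ.filter (fun S : Finset α => S.Nonempty), q ^ S.card + 1 := by
    rw [← Finset.sum_filter_add_sum_filter_not Finset.univ (fun S : Finset α => S.Nonempty)]
    simp [Finset.not_nonempty_iff_eq_empty, Finset.filter_eq']
  have h3 : (q + 1) ^ Fintype.card α ≤ Real.exp (Fintype.card α * q) := by
    rw [Real.exp_nat_mul]
    exact pow_le_pow_left₀ (by linarith) (Real.add_one_le_exp q) _
  linarith

open Classical in
/-- If the graph `R ∪ image g` splits along `S`, then `g` avoids the product of `S` with the
`R`-neighbours of `Sᶜ`; this product has at least `#S * t` elements when `#S` is at most half of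
`Fintype.card α`. -/
theorem card_hasSmallSplit_union_le {α β : Type*} [Fintype α] [Fintype β] [Nonempty α] [Nonempty β]
    (m : ℕ) {t : ℕ} {R : Finset (α × β)} (hR : IsSpread t R) :
    ((Finset.univ.filter fun g : Fin m → α × β =>
        HasSmallSplit (R ∪ Finset.univ.image g)).card : ℝ) ≤
      (Real.exp (Fintype.card α *
        Real.exp (-(t * m / (Fintype.card α * Fintype.card β)))) - 1) *
        (Fintype.card α * Fintype.card β) ^ m := by
  set K : ℝ := Fintype.card α * Fintype.card β with hK
  have hKpos : 0 < K := by positivity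
  set q : ℝ := Real.exp (-(t * m / K)) with hq
  let I : Finset (Finset α) := Finset.univ.filter fun S => S.Nonempty ∧ 2 * S.card ≤ Fintype.card α
  have hsub : (Finset.univ.filter fun g : Fin m → α × β =>
      HasSmallSplit (R ∪ Finset.univ.image g)) ⊆
      I.biUnion fun S => Fintype.piFinset fun _ : Fin m => (S ×ˢ neighbors R Sᶜ)ᶜ := by
    intro g hg
    simp only [Finset.mem_filter, Finset.mem_univ, true_and] at hg
    obtain ⟨S, hS, hS2, hsplit⟩ := hg
    rw [Finset.mem_biUnion]
    refine ⟨S, by simp [I, hS, hS2], ?_⟩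
    rw [Fintype.mem_piFinset]
    intro i
    rw [Finset.mem_compl, Finset.mem_product]
    rintro ⟨h1, h2⟩
    obtain ⟨y, hy, hyR⟩ := mem_neighbors.1 h2
    exact hsplit _ h1 y (Finset.mem_compl.1 hy) (g i).2 (by simp) (Finset.mem_union_left _ hyR)
  have hterm : ∀ S ∈ I,
      ((Fintype.piFinset fun _ : Fin m => (S ×ˢ neighbors R Sᶜ)ᶜ).card : ℝ) ≤
        q ^ S.card * K ^ m := by
    intro S hS
    simp only [I, Finset.mem_filter, Finset.mem_univ, true_and] at hS
    have hsp : t ≤ (neighbors R Sᶜ).card := hR _ (by rw [Finset.card_compl]; omega)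
    have hqS : q ^ S.card * K ^ m = (K * Real.exp (-(S.card * t / K))) ^ m := by
      rw [mul_pow K, hq, ← Real.exp_nat_mul, ← Real.exp_nat_mul, mul_comm]
      congr 2
      ring
    rw [Fintype.card_piFinset_const, Nat.cast_pow, hqS]
    refine pow_le_pow_left₀ (Nat.cast_nonneg _) ?_ m
    rw [card_compl_product, ← hK]
    have h1 : (S.card : ℝ) * t ≤ S.card * (neighbors R Sᶜ).card := by gcongr
    have h2 : K * (1 - S.card * t / K) ≤ K * Real.exp (-(S.card * t / K)) := by
      gcongr
      linarith [Real.add_one_le_exp (-(S.card * t / K))]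
    have h3 : K * (1 - S.card * t / K) = K - S.card * t := by field_simp
    linarith
  calc _ ≤ ((I.biUnion fun S =>
          Fintype.piFinset fun _ : Fin m => (S ×ˢ neighbors R Sᶜ)ᶜ).card : ℝ) := by
        exact_mod_cast Finset.card_le_card hsub
    _ ≤ ∑ S ∈ I, ((Fintype.piFinset fun _ : Fin m => (S ×ˢ neighbors R Sᶜ)ᶜ).card : ℝ) := by
        exact_mod_cast Finset.card_biUnion_le
    _ ≤ ∑ S ∈ I, q ^ S.card * K ^ m := Finset.sum_le_sum hterm
    _ ≤ ∑ S ∈ Finset.univ.filter (fun S : Finset α => S.Nonempty), q ^ S.card * K ^ m := by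
        refine Finset.sum_le_sum_of_subset_of_nonneg ?_ fun _ _ _ => by positivity
        exact Finset.monotone_filter_right _ fun S _ hS => hS.1
    _ = (∑ S ∈ Finset.univ.filter (fun S : Finset α => S.Nonempty), q ^ S.card) * K ^ m := by
        rw [Finset.sum_mul]
    _ ≤ _ := by
        gcongr
        exact sum_nonempty_pow_card_le (Real.exp_nonneg _)

open Classical in
/-- A sequence of length `m + m` is split into its two halves: either the first half is not spread,
or the first half is spread and the second one produces no edge across some small set. -/
theorem card_hasSmallSplit_image_le {α β : Type*} [Fintype α] [Fintype β] [Nonempty α] [Nonempty β]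
    (m : ℕ) {t : ℕ} (ht : 2 * t ≤ Fintype.card β) :
    ((Finset.univ.filter fun f : Fin m ⊕ Fin m → α × β =>
        HasSmallSplit (Finset.univ.image f)).card : ℝ) ≤
      (2 ^ Fintype.card α * (Fintype.card β : ℝ) ^ t * (3 / 4) ^ m +
        (Real.exp (Fintype.card α *
          Real.exp (-(t * m / (Fintype.card α * Fintype.card β)))) - 1)) *
        (Fintype.card α * Fintype.card β) ^ (m + m) := by
  set K : ℝ := Fintype.card α * Fintype.card β with hK
  set b : ℝ := Real.exp (Fintype.card α * Real.exp (-(t * m / K))) - 1 with hb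
  have hb0 : 0 ≤ b := by
    have := Real.add_one_le_exp (Fintype.card α * Real.exp (-(t * m / K)))
    have h0 : 0 ≤ Fintype.card α * Real.exp (-(t * m / K)) := by positivity
    linarith
  have himage : ∀ p : (Fin m → α × β) × (Fin m → α × β),
      Finset.univ.image ((Equiv.sumArrowEquivProdArrow _ _ _).symm p) =
        Finset.univ.image p.1 ∪ Finset.univ.image p.2 := by
    rintro ⟨f, g⟩
    ext x
    simp
  have hcard : (Finset.univ.filter fun f : Fin m ⊕ Fin m → α × β =>
        HasSmallSplit (Finset.univ.image f)).card =
      ∑ f : Fin m → α × β, (Finset.univ.filter fun g : Fin m → α × β =>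
        HasSmallSplit (Finset.univ.image f ∪ Finset.univ.image g)).card := by
    simp only [Finset.card_filter]
    rw [← Fintype.sum_prod_type', ← Equiv.sum_comp (Equiv.sumArrowEquivProdArrow _ _ _).symm]
    refine Finset.sum_congr rfl fun p _ => ?_
    simp only [himage]
  have hcardfun : (Fintype.card (Fin m → α × β) : ℝ) = K ^ m := by simp [hK]
  rw [hcard, Nat.cast_sum,
    ← Finset.sum_filter_not_add_sum_filter Finset.univ
      (fun f : Fin m → α × β => IsSpread t (Finset.univ.image f)), add_mul]
  gcongr ?_ + ?_
  · calc _ ≤ ((Finset.univ.filter fun f : Fin m → α × β =>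
            ¬ IsSpread t (Finset.univ.image f)).card : ℝ) * K ^ m := by
          rw [← nsmul_eq_mul]
          refine Finset.sum_le_card_nsmul _ _ _ fun f _ => ?_
          rw [← hcardfun]
          exact_mod_cast Finset.card_le_univ _
      _ ≤ (2 ^ Fintype.card α * (Fintype.card β : ℝ) ^ t * (3 / 4) ^ m * K ^ m) * K ^ m := by
          gcongr
          exact card_not_isSpread_le m ht
      _ = _ := by rw [pow_add]; ring
  · calc _ ≤ ((Finset.univ.filter fun f : Fin m → α × β =>
            IsSpread t (Finset.univ.image f)).card : ℝ) * (b * K ^ m) := by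
          rw [← nsmul_eq_mul]
          refine Finset.sum_le_card_nsmul _ _ _ fun f hf => ?_
          exact card_hasSmallSplit_union_le m (Finset.mem_filter.1 hf).2
      _ ≤ K ^ m * (b * K ^ m) := by
          gcongr
          rw [← hcardfun]
          exact_mod_cast Finset.card_le_univ _
      _ = _ := by rw [pow_add]; ring

/-! ### The failure probability in the positive model -/

open Classical in
theorem one_sub_le_positiveModelProb {n k N m t : ℕ} (hn : 0 < n) (ht : 2 * t ≤ n ^ k)
    (hN : 0 < N) (hmN : m + m ≤ N) (hNn : N ≤ n ^ (k + 1)) :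
    1 - (2 ^ n * ((n : ℝ) ^ k) ^ t * (3 / 4) ^ m +
        (Real.exp (n * Real.exp (-(t * m / (n : ℝ) ^ (k + 1)))) - 1)) ≤
      positiveModelProb n (k + 1) N fun R => IsCyclicWithEqualGenerators R := by
  have : Nonempty (Fin n) := ⟨⟨0, hn⟩⟩
  let e : (Fin (k + 1) → Fin n) ≃ Fin n × (Fin k → Fin n) := (Fin.consEquiv fun _ => Fin n).symm
  set δ : ℝ := 2 ^ n * ((n : ℝ) ^ k) ^ t * (3 / 4) ^ m +
        (Real.exp (n * Real.exp (-(t * m / (n : ℝ) ^ (k + 1)))) - 1) with hδ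
  set C : ℕ := (n ^ (k + 1)).choose N with hC
  have hCpos : (0 : ℝ) < C := by exact_mod_cast Nat.choose_pos hNn
  have hcardE : Fintype.card (Fin n × (Fin k → Fin n)) = n ^ (k + 1) := by
    simp [pow_succ, mul_comm]
  let bad : ℕ := ((Finset.powersetCard N (Finset.univ : Finset (Fin n × (Fin k → Fin n)))).filter
    HasSmallSplit).card
  have hbad : (bad : ℝ) ≤ δ * C := by
    have h1 := card_filter_powersetCard_mul_le (ι := Fin m ⊕ Fin m) (N := N)
      (E := Fin n × (Fin k → Fin n)) (B := HasSmallSplit)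
      (fun s t => HasSmallSplit.anti) (by simpa using hmN) (hcardE ▸ hNn)
    rw [hcardE] at h1
    have h2 := card_hasSmallSplit_image_le (α := Fin n) (β := Fin k → Fin n) m
      (t := t) (by simpa using ht)
    simp only [Fintype.card_fin, Fintype.card_pi, Finset.prod_const, Finset.card_univ,
      Nat.cast_pow, Fintype.card_sum, ← pow_succ'] at h1 h2
    have h3 : (bad : ℝ) * ((n : ℝ) ^ (k + 1)) ^ (m + m) ≤
        δ * ((n : ℝ) ^ (k + 1)) ^ (m + m) * C := by
      refine le_trans ?_ (mul_le_mul_of_nonneg_right h2 hCpos.le)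
      norm_cast
      convert h1
    refine le_of_mul_le_mul_right (h3.trans_eq (by ring)) (?_ : 0 < ((n : ℝ) ^ (k + 1)) ^ (m + m))
    positivity
  have htot : (relatorSets n (k + 1) N).card = C := by simp [relatorSets, hC]
  have hcompl : ((relatorSets n (k + 1) N).filter
      fun R => ¬ IsCyclicWithEqualGenerators R).card ≤ bad := by
    refine Finset.card_le_card_of_injOn (Equiv.finsetCongr e) (fun R hR => ?_)
      (Equiv.injective _).injOn
    simp only [Finset.coe_filter, relatorSets, Finset.mem_powersetCard_univ, Set.mem_ofPred_eq,
      Equiv.finsetCongr_apply, Finset.card_map] at hR ⊢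
    refine ⟨hR.1, by_contra fun hns => hR.2 ?_⟩
    refine isCyclicWithEqualGenerators_of_forall_eq k.succ_ne_zero ?_
      (forall_of_eq_of_of_not_hasSmallSplit hns)
    rw [← Finset.card_pos]
    omega
  have hsum : (((relatorSets n (k + 1) N).filter fun R => IsCyclicWithEqualGenerators R).card : ℝ) +
      ((relatorSets n (k + 1) N).filter fun R => ¬ IsCyclicWithEqualGenerators R).card = C := by
    rw [← htot]
    exact_mod_cast Finset.card_filter_add_card_filter_not _
  have hcompl' : (((relatorSets n (k + 1) N).filter
      fun R => ¬ IsCyclicWithEqualGenerators R).card : ℝ) ≤ bad := by exact_mod_cast hcompl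
  rw [positiveModelProb, htot, le_div_iff₀ hCpos]
  linarith

theorem positiveModelProb_le_one (n k N : ℕ) (P : Finset (Fin k → Fin n) → Prop) :
    positiveModelProb n k N P ≤ 1 := by
  classical
  refine div_le_one_of_le₀ ?_ (Nat.cast_nonneg _)
  exact_mod_cast Finset.card_filter_le _ _

/-! ### Asymptotics -/

theorem tendsto_natCast_rpow_atTop {r : ℝ} (hr : 0 < r) :
    Tendsto (fun n : ℕ => (n : ℝ) ^ r) atTop atTop :=
  (tendsto_rpow_atTop hr).comp tendsto_natCast_atTop_atTop

theorem eventually_mul_rpow_le_rpow (C : ℝ) {r s : ℝ} (h : r < s) :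
    ∀ᶠ n : ℕ in atTop, C * (n : ℝ) ^ r ≤ (n : ℝ) ^ s := by
  filter_upwards [(tendsto_natCast_rpow_atTop (sub_pos.2 h)).eventually_ge_atTop C,
    eventually_gt_atTop 0] with n hn hn0
  have hn0' : (0 : ℝ) < n := by exact_mod_cast hn0
  calc C * (n : ℝ) ^ r ≤ (n : ℝ) ^ (s - r) * (n : ℝ) ^ r := by gcongr
    _ = (n : ℝ) ^ s := by rw [← Real.rpow_add hn0', sub_add_cancel]

theorem tendsto_floor_rpow_div_rpow {r : ℝ} (hr : 0 < r) :
    Tendsto (fun n : ℕ => (⌊(n : ℝ) ^ r⌋₊ : ℝ) / (n : ℝ) ^ r) atTop (𝓝 1) :=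
  tendsto_nat_floor_div_atTop.comp (tendsto_natCast_rpow_atTop hr)

theorem tendsto_log_div_rpow {r : ℝ} (hr : 0 < r) :
    Tendsto (fun n : ℕ => Real.log n / (n : ℝ) ^ r) atTop (𝓝 0) :=
  (isLittleO_log_rpow_atTop hr).tendsto_div_nhds_zero.comp tendsto_natCast_atTop_atTop

theorem tendsto_not_isSpread_bound (k : ℕ) {a c : ℝ} (ha : 0 < a) (hac : a < c) (hc : 1 < c) :
    Tendsto (fun n : ℕ => 2 ^ n * ((n : ℝ) ^ k) ^ ⌊(n : ℝ) ^ a⌋₊ * (3 / 4) ^ ⌊(n : ℝ) ^ c⌋₊)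
      atTop (𝓝 0) := by
  have h1 : Tendsto (fun n : ℕ => (n : ℝ) / (n : ℝ) ^ c) atTop (𝓝 0) := by
    have := (tendsto_natCast_rpow_atTop (sub_pos.2 hc)).inv_tendsto_atTop
    refine this.congr' ?_
    filter_upwards [eventually_gt_atTop 0] with n hn
    have hn' : (0 : ℝ) < n := by exact_mod_cast hn
    rw [Pi.inv_apply, Real.rpow_sub hn', Real.rpow_one, inv_div]
  have h2 := (tendsto_floor_rpow_div_rpow ha).mul (tendsto_log_div_rpow (sub_pos.2 hac))
  have h3 := tendsto_floor_rpow_div_rpow (zero_lt_one.trans hc)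
  have hlim := ((h1.mul_const (Real.log 2)).add (h2.const_mul (k : ℝ))).add
    (h3.mul_const (Real.log (3 / 4)))
  -- After dividing by `n ^ c`, the logarithm of the bound tends to `log (3 / 4) < 0`.
  have hneg : 0 * Real.log 2 + k * (1 * 0) + 1 * Real.log (3 / 4) < 0 := by
    have := Real.log_neg (x := 3 / 4) (by norm_num) (by norm_num)
    linarith
  have hexp := (tendsto_natCast_rpow_atTop (zero_lt_one.trans hc)).atTop_mul_neg hneg hlim
  refine (Real.tendsto_exp_atBot.comp hexp).congr' ?_
  filter_upwards [eventually_gt_atTop 0] with n hn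
  have hn' : (0 : ℝ) < n := by exact_mod_cast hn
  have e1 : (2 : ℝ) ^ n = Real.exp (n * Real.log 2) := by
    rw [Real.exp_nat_mul, Real.exp_log two_pos]
  have e2 : ((n : ℝ) ^ k) ^ ⌊(n : ℝ) ^ a⌋₊ =
      Real.exp (⌊(n : ℝ) ^ a⌋₊ * (k * Real.log n)) := by
    rw [Real.exp_nat_mul, Real.exp_nat_mul, Real.exp_log hn']
  have e3 : (3 / 4 : ℝ) ^ ⌊(n : ℝ) ^ c⌋₊ = Real.exp (⌊(n : ℝ) ^ c⌋₊ * Real.log (3 / 4)) := by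
    rw [Real.exp_nat_mul, Real.exp_log (by norm_num)]
  rw [e1, e2, e3, ← Real.exp_add, ← Real.exp_add, Function.comp_apply]
  congr 1
  have hsub := Real.rpow_sub hn' c a
  have hpa := Real.rpow_pos_of_pos hn' a
  have hpc := Real.rpow_pos_of_pos hn' c
  rw [hsub]
  field_simp

theorem tendsto_split_bound (k : ℕ) {a c : ℝ} (ha : 0 < a) (hc : 0 < c) (hac : k < a + c) :
    Tendsto (fun n : ℕ => Real.exp (n * Real.exp
      (-(⌊(n : ℝ) ^ a⌋₊ * ⌊(n : ℝ) ^ c⌋₊ / (n : ℝ) ^ k))) - 1) atTop (𝓝 0) := by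
  have hpos : 0 < a + c - k := sub_pos.2 hac
  have hlim := (tendsto_log_div_rpow hpos).sub
    ((tendsto_floor_rpow_div_rpow ha).mul (tendsto_floor_rpow_div_rpow hc))
  -- The logarithm of `n * exp (…)`, divided by `n ^ (a + c - k)`, tends to `-1`.
  have hexp := (tendsto_natCast_rpow_atTop hpos).atTop_mul_neg (by norm_num) hlim
  have h : Tendsto (fun n : ℕ => (n : ℝ) * Real.exp
      (-(⌊(n : ℝ) ^ a⌋₊ * ⌊(n : ℝ) ^ c⌋₊ / (n : ℝ) ^ k))) atTop (𝓝 0) := by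
    refine (Real.tendsto_exp_atBot.comp hexp).congr' ?_
    filter_upwards [eventually_gt_atTop 0] with n hn
    have hn' : (0 : ℝ) < n := by exact_mod_cast hn
    have key : ∀ x : ℝ, (n : ℝ) * Real.exp x = Real.exp (Real.log n + x) := fun x => by
      rw [Real.exp_add, Real.exp_log hn']
    rw [key, Function.comp_apply]
    congr 1
    have hpa := Real.rpow_pos_of_pos hn' a
    have hpc := Real.rpow_pos_of_pos hn' c
    rw [Real.rpow_sub hn', Real.rpow_add hn', Real.rpow_natCast]
    field_simp
    ring
  simpa using ((Real.continuous_exp.tendsto 0).comp h).sub_const 1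

/-- Any number of relators between `⌊n ^ e⌋` with `e > (k + 1) / 2` and the number `n ^ (k + 1)` of
all words suffices. -/
theorem tendsto_positiveModelProb {k : ℕ} (hk : 1 ≤ k) {e : ℝ} (he : ((k + 1 : ℕ) : ℝ) / 2 < e)
    {N : ℕ → ℕ} (hN : ∀ᶠ n : ℕ in atTop, ⌊(n : ℝ) ^ e⌋₊ ≤ N n)
    (hN' : ∀ᶠ n : ℕ in atTop, N n ≤ n ^ (k + 1)) :
    Tendsto (fun n => positiveModelProb n (k + 1) (N n)
      fun R => IsCyclicWithEqualGenerators R) atTop (𝓝 1) := by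
  have hk' : (1 : ℝ) ≤ k := by exact_mod_cast hk
  push_cast at he
  obtain ⟨c, hc1, hce⟩ := exists_between he
  -- An exponent `a` exists since `k + 1 - c < c` by `hc1`, and `k + 1 - c < k` as `c > 1`.
  obtain ⟨a, ha1, ha2⟩ : ∃ a : ℝ, max 0 (k + 1 - c) < a ∧ a < min c k :=
    exists_between (max_lt (lt_min (by linarith) (by linarith)) (lt_min (by linarith) (by linarith)))
  obtain ⟨ha0, hac⟩ := max_lt_iff.1 ha1
  obtain ⟨hac', hak⟩ := lt_min_iff.1 ha2
  have h1 := tendsto_not_isSpread_bound k ha0 hac' (by linarith)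
  have h2 := tendsto_split_bound (k + 1) ha0 (ha0.trans hac') (by push_cast; linarith)
  have hlow := (h1.add h2).const_sub 1
  rw [add_zero, sub_zero] at hlow
  refine tendsto_of_tendsto_of_tendsto_of_le_of_le' hlow tendsto_const_nhds ?_
    (Eventually.of_forall fun n => positiveModelProb_le_one _ _ _ _)
  filter_upwards [hN, hN', eventually_gt_atTop 0, eventually_mul_rpow_le_rpow 2 hak,
    eventually_mul_rpow_le_rpow 2 hce] with n hn hn' hn0 hta hme
  have hn1 : (1 : ℝ) ≤ n := by exact_mod_cast hn0
  refine one_sub_le_positiveModelProb hn0 ?_ ?_ ?_ hn'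
  · have := Nat.floor_le (Real.rpow_nonneg (Nat.cast_nonneg n) a)
    rw [Real.rpow_natCast] at hta
    have h : (2 : ℝ) * ⌊(n : ℝ) ^ a⌋₊ ≤ (n : ℝ) ^ k := by linarith
    exact_mod_cast h
  · refine lt_of_lt_of_le ?_ hn
    exact Nat.floor_pos.2 (Real.one_le_rpow hn1 (by linarith))
  · refine le_trans (Nat.le_floor ?_) hn
    have := Nat.floor_le (Real.rpow_nonneg (Nat.cast_nonneg n) c)
    push_cast
    linarith

theorem mainTheorem5 (k : ℕ) (hk : 2 ≤ k) (d : ℝ) (hd : 1 / 2 < d) (hd1 : d < 1) :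
    Tendsto (fun n : ℕ => positiveModelProb n k ⌊(n : ℝ) ^ ((k : ℝ) * d)⌋₊
        (fun R => IsCyclicWithEqualGenerators R)) atTop (𝓝 1) ∧
      Tendsto (fun n : ℕ => positiveModelProb n k ⌊(2 * (n : ℝ) - 1) ^ ((k : ℝ) * d)⌋₊
        (fun R => IsCyclicWithEqualGenerators R)) atTop (𝓝 1) := by
  obtain ⟨k, rfl⟩ : ∃ l, k = l + 1 := ⟨k - 1, by omega⟩
  have hkpos : (0 : ℝ) < (k + 1 : ℕ) := by positivity
  have he : ((k + 1 : ℕ) : ℝ) / 2 < (k + 1 : ℕ) * d := by nlinarith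
  have he' : ((k + 1 : ℕ) : ℝ) * d < (k + 1 : ℕ) := by nlinarith
  have he0 : 0 ≤ ((k + 1 : ℕ) : ℝ) * d := by positivity
  set e : ℝ := ((k + 1 : ℕ) : ℝ) * d
  have hupper := eventually_mul_rpow_le_rpow (2 ^ e) he'
  have hle : ∀ᶠ n : ℕ in atTop, ⌊(n : ℝ) ^ e⌋₊ ≤ ⌊(2 * (n : ℝ) - 1) ^ e⌋₊ := by
    filter_upwards [eventually_gt_atTop 0] with n hn
    have hn1 : (1 : ℝ) ≤ n := by exact_mod_cast hn
    exact Nat.floor_le_floor (Real.rpow_le_rpow (by linarith) (by linarith) he0)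
  have hmax : ∀ᶠ n : ℕ in atTop, ⌊(2 * (n : ℝ) - 1) ^ e⌋₊ ≤ n ^ (k + 1) := by
    filter_upwards [hupper, eventually_gt_atTop 0] with n h hn
    have hn1 : (1 : ℝ) ≤ n := by exact_mod_cast hn
    refine Nat.floor_le_of_le ?_
    rw [← Real.mul_rpow two_pos.le (by linarith), Real.rpow_natCast] at h
    push_cast
    exact (Real.rpow_le_rpow (by linarith) (by linarith) he0).trans h
  exact ⟨tendsto_positiveModelProb (by omega) he (Eventually.of_forall fun _ => le_rfl)
      ((hle.and hmax).mono fun n h => h.1.trans h.2),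
    tendsto_positiveModelProb (by omega) he hle hmax⟩
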